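/- A graph function is a Borel measurable function $g:[0,1]^2\to[0,1]$ with $g(x,y)=g(y,x)$ for almost every $(x,y)$. For a bounded measurable $w$ on $[0,1]^2$ let $\|w\|_{\square}=\sup_{S,T}\left|\int_{S\times T}w\right|$, the supremum being over measurable $S,T\subset[0,1]$. Two graph functions $g_1,g_2$ are equivalent if $\inf_\sigma\|g_1^\sigma-g_2\|_\square=0$, where $g^\sigma(x,y)=g(\sigma(x),\sigma(y))$ and $\sigma$ runs over the Lebesgue-measure-preserving measurable bijections of $[0,1]$; a graphon $\gamma=[g]$ is an equivalence class of graph functions. Its edge density is $\iint_{[0,1]^2} g(x,y)\,dx\,dy$ (independent of the representative $g$), and for $p\in[0,1]$, $\gamma_p$ denotes the class of the constant function $p$. For a graph function $g$ let $T_g$ be the operator on $L^2([0,1])$ defined by $(T_gf)(x)=\int_0^1 g(x,y)f(y)\,dy$, let $(\lambda_i)_{i\in I}$ be its nonzero eigenvalues, repeated according to multiplicity, and set $$\mathrm{det}_3(\mathrm{id}+zT_g)=\prod_{i\in I}(1+z\lambda_i)\,e^{-z\lambda_i+z^2\lambda_i^2/2},\qquad z\in\mathbb{C}.$$ **Proposition.**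 Let $\gamma$ be a graphon, $g$ any graph function representing $\gamma$, and $p\in[0,1]$. The product defining $\mathrm{det}_3(\gamma,z)=\mathrm{det}_3(\mathrm{id}+zT_g)$ converges unconditionally for every $z\in\mathbb{C}$, and the following are equivalent: 1. $\gamma=\gamma_p$; 2. $\gamma$ has edge density $p$, and $\mathrm{det}_3(\gamma,z)=(1+pz)\,e^{-pz+p^2z^2/2}$ for all $z\in\mathbb{C}$. -/

import Mathlib

open MeasureTheory
open scoped ENNReal

noncomputable section

/-- A graph function: a Borel function on the unit square with values in `[0,1]`, symmetric almost
everywhere for the Lebesgue measure. Functions that agree almost everywhere are identified later,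
in the quotient `Graphon`. -/
structure GraphFunction where
  toFun : unitInterval × unitInterval → ℝ
  measurable' : Measurable toFun
  mem_Icc' : ∀ z, toFun z ∈ Set.Icc (0 : ℝ) 1
  symm' : ∀ᵐ z : unitInterval × unitInterval, toFun (z.1, z.2) = toFun (z.2, z.1)

/-- The cut norm of a (bounded measurable) function on the unit square. -/
def cutNorm (w : unitInterval × unitInterval → ℝ) : ℝ :=
  ⨆ P : {S : Set unitInterval // MeasurableSet S} × {T : Set unitInterval // MeasurableSet T},
    |∫ z in (P.1 : Set unitInterval) ×ˢ (P.2 : Set unitInterval), w z|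

/-- Lebesgue isomorphisms of `[0,1]`: measurable bijections preserving the Lebesgue measure
(the inverse of a Borel bijection of `[0,1]` is automatically Borel). -/
def LebesgueIso : Type := {σ : unitInterval ≃ᵐ unitInterval // MeasurePreserving σ volume volume}

namespace LebesgueIso

def id : LebesgueIso := ⟨MeasurableEquiv.refl unitInterval, MeasurePreserving.id _⟩

def inv (σ : LebesgueIso) : LebesgueIso := ⟨σ.1.symm, σ.2.symm σ.1⟩

def comp (σ τ : LebesgueIso) : LebesgueIso := ⟨τ.1.trans σ.1, σ.2.comp τ.2⟩

instance : Nonempty LebesgueIso := ⟨id⟩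

/-- The action of a Lebesgue isomorphism on the unit square. -/
def square (σ : LebesgueIso) : unitInterval × unitInterval ≃ᵐ unitInterval × unitInterval := σ.1.prodCongr σ.1

theorem square_apply (σ : LebesgueIso) (z : unitInterval × unitInterval) : σ.square z = (σ.1 z.1, σ.1 z.2) := rfl

theorem measurePreserving_square (σ : LebesgueIso) :
    MeasurePreserving σ.square volume volume :=
  σ.2.prod σ.2

end LebesgueIso

/-- The right action `w ↦ w^σ`, `w^σ(x,y) = w(σ x, σ y)`. -/
def relabel (σ : LebesgueIso) (w : unitInterval × unitInterval → ℝ) : unitInterval × unitInterval → ℝ :=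
  fun z => w (σ.1 z.1, σ.1 z.2)

theorem cutNorm_nonneg (w : unitInterval × unitInterval → ℝ) : 0 ≤ cutNorm w :=
  Real.iSup_nonneg fun _ => abs_nonneg _

theorem cutNorm_bddAbove {w : unitInterval × unitInterval → ℝ} (hw : Integrable w) :
    BddAbove (Set.range fun P : {S : Set unitInterval // MeasurableSet S} × {T : Set unitInterval // MeasurableSet T} =>
      |∫ z in (P.1 : Set unitInterval) ×ˢ (P.2 : Set unitInterval), w z|) := by
  refine ⟨∫ z, |w z|, ?_⟩
  rintro _ ⟨P, rfl⟩
  refine (abs_integral_le_integral_abs).trans ?_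
  exact setIntegral_le_integral hw.abs (Filter.Eventually.of_forall fun _ => abs_nonneg _)

theorem le_cutNorm {w : unitInterval × unitInterval → ℝ} (hw : Integrable w) {S T : Set unitInterval}
    (hS : MeasurableSet S) (hT : MeasurableSet T) :
    |∫ z in S ×ˢ T, w z| ≤ cutNorm w :=
  le_ciSup (cutNorm_bddAbove hw) (⟨S, hS⟩, ⟨T, hT⟩)

theorem cutNorm_sub_comm (u v : unitInterval × unitInterval → ℝ) :
    cutNorm (fun z => u z - v z) = cutNorm (fun z => v z - u z) := by
  unfold cutNorm
  congr 1
  funext P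
  rw [← abs_neg, ← integral_neg]
  simp

theorem cutNorm_sub_le {u v w : unitInterval × unitInterval → ℝ} (hu : Integrable u) (hv : Integrable v)
    (hw : Integrable w) :
    cutNorm (fun z => u z - w z) ≤
      cutNorm (fun z => u z - v z) + cutNorm (fun z => v z - w z) := by
  have : Nonempty ({S : Set unitInterval // MeasurableSet S} × {T : Set unitInterval // MeasurableSet T}) :=
    ⟨(⟨∅, .empty⟩, ⟨∅, .empty⟩)⟩
  refine ciSup_le fun P => ?_
  have e : ∫ z in (P.1 : Set unitInterval) ×ˢ (P.2 : Set unitInterval), (u z - w z) =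
      (∫ z in (P.1 : Set unitInterval) ×ˢ (P.2 : Set unitInterval), (u z - v z)) +
        ∫ z in (P.1 : Set unitInterval) ×ˢ (P.2 : Set unitInterval), (v z - w z) := by
    have ha := integral_add (hu.sub hv).integrableOn (hv.sub hw).integrableOn
      (μ := volume.restrict ((P.1 : Set unitInterval) ×ˢ (P.2 : Set unitInterval)))
    simp only [Pi.sub_apply] at ha
    rw [← ha]
    simp
  rw [e]
  exact (abs_add_le _ _).trans
    (add_le_add (le_cutNorm (hu.sub hv) P.1.2 P.2.2) (le_cutNorm (hv.sub hw) P.1.2 P.2.2))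

theorem integrable_relabel (σ : LebesgueIso) {w : unitInterval × unitInterval → ℝ} (hw : Integrable w) :
    Integrable (relabel σ w) :=
  (σ.measurePreserving_square.integrable_comp_emb σ.square.measurableEmbedding).2 hw

theorem cutNorm_relabel_le (σ : LebesgueIso) {w : unitInterval × unitInterval → ℝ} (hw : Integrable w) :
    cutNorm (relabel σ w) ≤ cutNorm w := by
  have : Nonempty ({S : Set unitInterval // MeasurableSet S} × {T : Set unitInterval // MeasurableSet T}) :=
    ⟨(⟨∅, .empty⟩, ⟨∅, .empty⟩)⟩
  refine ciSup_le fun P => ?_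
  have h := σ.measurePreserving_square.setIntegral_preimage_emb
    σ.square.measurableEmbedding w
    ((σ.1.symm ⁻¹' (P.1 : Set unitInterval)) ×ˢ (σ.1.symm ⁻¹' (P.2 : Set unitInterval)))
  have hpre : σ.square ⁻¹' ((σ.1.symm ⁻¹' (P.1 : Set unitInterval)) ×ˢ (σ.1.symm ⁻¹' (P.2 : Set unitInterval))) =
      (P.1 : Set unitInterval) ×ˢ (P.2 : Set unitInterval) := by
    ext z
    simp [LebesgueIso.square_apply]
  rw [hpre] at h
  have h' : ∫ z in (P.1 : Set unitInterval) ×ˢ (P.2 : Set unitInterval), relabel σ w z =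
      ∫ z in (P.1 : Set unitInterval) ×ˢ (P.2 : Set unitInterval), w (σ.square z) := rfl
  rw [h', h]
  exact le_cutNorm hw (σ.1.symm.measurable P.1.2) (σ.1.symm.measurable P.2.2)

namespace GraphFunction

theorem integrable (g : GraphFunction) : Integrable g.toFun :=
  Integrable.of_bound g.measurable'.aestronglyMeasurable 1
    (Filter.Eventually.of_forall fun z => by
      rw [Real.norm_eq_abs, abs_of_nonneg (g.mem_Icc' z).1]
      exact (g.mem_Icc' z).2)

/-- The cut metric `δ(g₁,g₂) = inf_σ ‖g₁^σ - g₂‖`. -/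
def cutDist (g₁ g₂ : GraphFunction) : ℝ :=
  ⨅ σ : LebesgueIso, cutNorm (fun z => relabel σ g₁.toFun z - g₂.toFun z)

theorem cutDist_nonneg (g₁ g₂ : GraphFunction) : 0 ≤ cutDist g₁ g₂ :=
  le_ciInf fun _ => cutNorm_nonneg _

theorem cutDist_le (g₁ g₂ : GraphFunction) (σ : LebesgueIso) :
    cutDist g₁ g₂ ≤ cutNorm (fun z => relabel σ g₁.toFun z - g₂.toFun z) :=
  ciInf_le ⟨0, by rintro _ ⟨τ, rfl⟩; exact cutNorm_nonneg _⟩ σ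

theorem cutDist_self (g : GraphFunction) : cutDist g g = 0 := by
  refine le_antisymm ((cutDist_le g g LebesgueIso.id).trans ?_) (cutDist_nonneg g g)
  simp [relabel, LebesgueIso.id, cutNorm]

theorem cutDist_comm_le (g₁ g₂ : GraphFunction) : cutDist g₂ g₁ ≤ cutDist g₁ g₂ := by
  refine le_ciInf fun σ => (cutDist_le g₂ g₁ σ.inv).trans ?_
  rw [cutNorm_sub_comm]
  have h := cutNorm_relabel_le σ.inv ((integrable_relabel σ g₁.integrable).sub g₂.integrable)
  refine le_trans (le_of_eq ?_) h
  congr 1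
  funext z
  simp [relabel, LebesgueIso.inv]

theorem cutDist_triangle (g₁ g₂ g₃ : GraphFunction) :
    cutDist g₁ g₃ ≤ cutDist g₁ g₂ + cutDist g₂ g₃ := by
  refine le_ciInf_add_ciInf fun σ τ => (cutDist_le g₁ g₃ (σ.comp τ)).trans ?_
  have h := cutNorm_relabel_le τ ((integrable_relabel σ g₁.integrable).sub g₂.integrable)
  have h3 := cutNorm_sub_le (integrable_relabel (σ.comp τ) g₁.integrable)
    (integrable_relabel τ g₂.integrable) g₃.integrable
  exact h3.trans (add_le_add_left h _)

/-- Two graph functions are equivalent when their cut distance vanishes. -/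
instance setoid : Setoid GraphFunction where
  r g₁ g₂ := cutDist g₁ g₂ = 0
  iseqv :=
    { refl := cutDist_self
      symm := fun {g₁ g₂} h =>
        le_antisymm ((cutDist_comm_le g₁ g₂).trans h.le) (cutDist_nonneg _ _)
      trans := fun {g₁ g₂ g₃} h h' =>
        le_antisymm ((cutDist_triangle g₁ g₂ g₃).trans (by rw [h, h', add_zero]))
          (cutDist_nonneg _ _) }

/-- The constant graph function `g(x,y) = p`. -/
def const (p : ℝ) (hp : p ∈ Set.Icc (0 : ℝ) 1) : GraphFunction where
  toFun := fun _ => p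
  measurable' := measurable_const
  mem_Icc' := fun _ => hp
  symm' := Filter.Eventually.of_forall fun _ => rfl

/-- The density of the graph with two vertices and one edge: `∫∫ g(x,y) dx dy`. -/
def edgeDensity (g : GraphFunction) : ℝ := ∫ z : unitInterval × unitInterval, g.toFun z

theorem abs_edgeDensity_sub_le (g₁ g₂ : GraphFunction) :
    |edgeDensity g₁ - edgeDensity g₂| ≤ cutDist g₁ g₂ := by
  refine le_ciInf fun σ => ?_
  have h := le_cutNorm ((integrable_relabel σ g₁.integrable).sub g₂.integrable)
    MeasurableSet.univ MeasurableSet.univ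
  refine le_trans (le_of_eq ?_) h
  have hσ : ∫ z, relabel σ g₁.toFun z = ∫ z, g₁.toFun z :=
    σ.measurePreserving_square.integral_comp σ.square.measurableEmbedding g₁.toFun
  have hsub := integral_sub (integrable_relabel σ g₁.integrable) g₂.integrable
  simp only [Set.univ_prod_univ, Measure.restrict_univ, Pi.sub_apply]
  rw [hsub, hσ]
  rfl

/-! The integral operator on the real Hilbert space `L²([0,1])`. -/

/-- `x ↦ ∫ g(x,y) f(y) dy`. -/
def kernelIntegral (g : GraphFunction) (f : unitInterval → ℝ) (x : unitInterval) : ℝ := ∫ y, g.toFun (x, y) * f y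

theorem integrable_slice (g : GraphFunction) {f : unitInterval → ℝ} (hf : Integrable f) (x : unitInterval) :
    Integrable (fun y => g.toFun (x, y) * f y) :=
  hf.bdd_mul (c := 1)
    (g.measurable'.comp measurable_prodMk_left).aestronglyMeasurable
    (Filter.Eventually.of_forall fun y => by
      rw [Real.norm_eq_abs, abs_of_nonneg (g.mem_Icc' _).1]
      exact (g.mem_Icc' _).2)

theorem integrable_of_Lp (f : Lp ℝ 2 (volume : Measure unitInterval)) : Integrable f :=
  (Lp.memLp f).integrable (by norm_num)

theorem norm_kernelIntegral_le (g : GraphFunction) (f : Lp ℝ 2 (volume : Measure unitInterval)) (x : unitInterval) :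
    ‖kernelIntegral g f x‖ ≤ ‖f‖ := by
  have hf := integrable_of_Lp f
  have h1 : ‖kernelIntegral g f x‖ ≤ ∫ y, ‖f y‖ := by
    refine norm_integral_le_of_norm_le hf.norm (Filter.Eventually.of_forall fun y => ?_)
    rw [norm_mul, Real.norm_eq_abs, abs_of_nonneg (g.mem_Icc' _).1]
    exact mul_le_of_le_one_left (norm_nonneg _) (g.mem_Icc' _).2
  refine h1.trans ?_
  rw [integral_norm_eq_lintegral_enorm hf.aestronglyMeasurable, Lp.norm_def,
    ← eLpNorm_one_eq_lintegral_enorm]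
  exact ENNReal.toReal_mono (Lp.eLpNorm_ne_top f)
    (eLpNorm_le_eLpNorm_of_exponent_le (by norm_num) hf.aestronglyMeasurable)

theorem memLp_kernelIntegral (g : GraphFunction) (f : Lp ℝ 2 (volume : Measure unitInterval)) :
    MemLp (kernelIntegral g f) 2 volume := by
  refine MemLp.of_bound ?_ ‖f‖ (Filter.Eventually.of_forall (norm_kernelIntegral_le g f))
  have hm : StronglyMeasurable fun z : unitInterval × unitInterval => g.toFun z * f z.2 :=
    g.measurable'.stronglyMeasurable.mul ((Lp.stronglyMeasurable f).comp_measurable measurable_snd)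
  exact hm.integral_prod_right'.aestronglyMeasurable

/-- The integral operator `T_g f (x) = ∫ g(x,y) f(y) dy` on `L²([0,1])`. -/
def integralOperator (g : GraphFunction) :
    Lp ℝ 2 (volume : Measure unitInterval) →L[ℝ] Lp ℝ 2 (volume : Measure unitInterval) :=
  LinearMap.mkContinuous
    { toFun := fun f => (memLp_kernelIntegral g f).toLp (kernelIntegral g f)
      map_add' := fun f₁ f₂ => by
        rw [← MemLp.toLp_add]
        refine MemLp.toLp_congr _ _ (Filter.Eventually.of_forall fun x => ?_)
        simp only [kernelIntegral, Pi.add_apply]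
        rw [← integral_add (integrable_slice g (integrable_of_Lp f₁) x)
          (integrable_slice g (integrable_of_Lp f₂) x)]
        refine integral_congr_ae ?_
        filter_upwards [Lp.coeFn_add f₁ f₂] with y hy
        rw [hy, Pi.add_apply, mul_add]
      map_smul' := fun c f => by
        rw [RingHom.id_apply, ← MemLp.toLp_const_smul]
        refine MemLp.toLp_congr _ _ (Filter.Eventually.of_forall fun x => ?_)
        simp only [kernelIntegral, Pi.smul_apply, smul_eq_mul]
        rw [← integral_const_mul]
        refine integral_congr_ae ?_
        filter_upwards [Lp.coeFn_smul c f] with y hy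
        rw [hy, Pi.smul_apply, smul_eq_mul]
        ring }
    1 (fun f => by
      rw [one_mul]
      refine Lp.norm_le_of_ae_bound (norm_nonneg f) ?_ |>.trans ?_
      · filter_upwards [(memLp_kernelIntegral g f).coeFn_toLp] with x hx
        exact hx ▸ norm_kernelIntegral_le g f x
      · simp [measureUnivNNReal])

/-- The multiplicity of the real number `l` as an eigenvalue of `T_g`, i.e. the dimension of
`ker (T_g - l)`; it is `0` when `l` is not an eigenvalue, and it is finite for `l ≠ 0`, because
`T_g` is a Hilbert-Schmidt operator. -/
def multiplicity (g : GraphFunction) (l : ℝ) : ℕ :=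
  Module.finrank ℝ (Module.End.eigenspace (integralOperator g).toLinearMap l)

/-- The factor `(1 + z l) exp (-z l + z² l² / 2)`, repeated according to multiplicity. It is equal
to `1` if `l = 0` and if `l` is not an eigenvalue of `T_g`. -/
def detFactor (g : GraphFunction) (z : ℂ) (l : ℝ) : ℂ :=
  ((1 + z * l) * Complex.exp (-(z * l) + z ^ 2 * (l : ℂ) ^ 2 / 2)) ^ multiplicity g l

/-- The `3`-modified Fredholm determinant `det₃(id + z T_g)`: the product, over the nonzero
eigenvalues `l` of `T_g` counted with multiplicity, of `(1 + z l) exp (-z l + z² l² / 2)`. -/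
def det₃ (g : GraphFunction) (z : ℂ) : ℂ := ∏' l : ℝ, detFactor g z l

end GraphFunction

/-- A graphon is a class of graph functions at cut distance zero. -/
def Graphon : Type := Quotient GraphFunction.setoid

namespace Graphon

/-- The class `[g]` of a graph function. -/
def mk (g : GraphFunction) : Graphon := Quotient.mk _ g

/-- The constant graphon `γ_p`. -/
def const (p : ℝ) (hp : p ∈ Set.Icc (0 : ℝ) 1) : Graphon := mk (GraphFunction.const p hp)

/-- The edge density of a graphon, i.e. that of any of its representatives. -/
def edgeDensity (γ : Graphon) : ℝ :=
  Quotient.lift GraphFunction.edgeDensity (fun g₁ g₂ (h : GraphFunction.cutDist g₁ g₂ = 0) =>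
    sub_eq_zero.1 (abs_nonpos_iff.1
      ((GraphFunction.abs_edgeDensity_sub_le g₁ g₂).trans h.le))) γ

end Graphon

end

/-! Bessel's inequality for the slices `g (x, ·)` shows that `T_g` is Hilbert–Schmidt. Hence it is
compact, and its squared eigenvalues, with multiplicity, are summable. Each factor of `det₃` is `1 +
O(|z l|²)`, so the product converges.

If `γ = γ_p`, then `g = p` almost everywhere: relabelling fixes constants, so the cut distance to
`p` is the cut norm of `g - p`. Then `T_g` is `p` times the projection onto the constants, and the
determinant is a single factor.

Conversely, let `p ≠ 0`. A nonzero eigenvalue `l` gives a zero of `det₃` at `-1/l`, while the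
prescribed function vanishes only at `-1/p`; so `p` is the only possible one. Evaluation at `1/p`
then shows that its multiplicity is one. By the spectral theorem `T_g = p ⟨e, ·⟩ e` with `e` a unit
vector, and edge density `p` forces `⟨1, e⟩² = 1`, so `e = ±1`. Thus `g` integrates over every
rectangle as `p` does. For `p = 0` the density alone suffices. -/

/-! ### Hilbert–Schmidt operators: compactness, eigenvalues, the rank-one case. -/

section HilbertSchmidt

variable {E : Type*} [NormedAddCommGroup E] [InnerProductSpace ℝ E]

/-- `T` has squared Hilbert–Schmidt norm at most `C`: the sum of `‖T e‖²` over any finite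
orthonormal family is at most `C`. -/
def HilbertSchmidtBound (T : E →L[ℝ] E) (C : ℝ) : Prop :=
  ∀ (n : ℕ) (e : Fin n → E), Orthonormal ℝ e → ∑ i, ‖T (e i)‖ ^ 2 ≤ C

theorem HilbertSchmidtBound.sum_le {T : E →L[ℝ] E} {C : ℝ} (h : HilbertSchmidtBound T C)
    {ι : Type*} [Fintype ι] {e : ι → E} (he : Orthonormal ℝ e) : ∑ i, ‖T (e i)‖ ^ 2 ≤ C := by
  have := h _ (e ∘ (Fintype.equivFin ι).symm) (he.comp _ (Equiv.injective _))
  rwa [← (Fintype.equivFin ι).symm.sum_comp]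

theorem orthonormal_fin_cons {n : ℕ} {e : Fin n → E} (he : Orthonormal ℝ e) {u : E}
    (hu : ‖u‖ = 1) (hue : ∀ i, inner ℝ u (e i) = 0) :
    Orthonormal ℝ (Fin.cons u e : Fin (n + 1) → E) := by
  refine ⟨fun i => ?_, fun i j hij => ?_⟩
  · induction i using Fin.cases with
    | zero => simpa using hu
    | succ i => simpa using he.1 i
  · induction i using Fin.cases with
    | zero =>
      induction j using Fin.cases with
      | zero => exact absurd rfl hij
      | succ j => simpa using hue j
    | succ i =>
      induction j using Fin.cases with
      | zero => simpa [real_inner_comm] using hue i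
      | succ j => simpa using he.2 (fun h => hij (congrArg _ h))

/-- Outside a suitable finite-dimensional subspace, a Hilbert–Schmidt operator is small. -/
theorem HilbertSchmidtBound.exists_small {T : E →L[ℝ] E} {C : ℝ} (h : HilbertSchmidtBound T C)
    {ε : ℝ} (hε : 0 < ε) :
    ∃ (n : ℕ) (e : Fin n → E), ∀ x, (∀ i, inner ℝ x (e i) = 0) → ‖T x‖ ≤ ε * ‖x‖ := by
  let A : Set ℝ := {s | ∃ (n : ℕ) (e : Fin n → E), Orthonormal ℝ e ∧ s = ∑ i, ‖T (e i)‖ ^ 2}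
  have hA : A.Nonempty := ⟨0, 0, Fin.elim0, ⟨fun i => i.elim0, fun i => i.elim0⟩, by simp⟩
  have hAb : BddAbove A := ⟨C, by rintro _ ⟨n, e, he, rfl⟩; exact h n e he⟩
  -- The family is within `ε²` of the supremum; adjoining an orthogonal unit vector `u` with `‖T u‖
  -- > ε` would exceed it.
  obtain ⟨_, ⟨n, e, he, rfl⟩, hs⟩ :=
    exists_lt_of_lt_csSup hA (show sSup A - ε ^ 2 < sSup A by linarith [pow_pos hε 2])
  refine ⟨n, e, fun x hx => ?_⟩
  rcases eq_or_ne x 0 with rfl | hx0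
  · simp
  have hxn : 0 < ‖x‖ := norm_pos_iff.2 hx0
  have ho := orthonormal_fin_cons he (u := ‖x‖⁻¹ • x) (by simp [norm_smul, hxn.ne'])
    (fun i => by rw [real_inner_smul_left, hx i, mul_zero])
  have h1 := le_csSup hAb ⟨n + 1, _, ho, rfl⟩
  rw [Fin.sum_univ_succ] at h1
  simp only [Fin.cons_zero, Fin.cons_succ] at h1
  have h2 : ‖T (‖x‖⁻¹ • x)‖ ≤ ε := by
    refine le_of_sq_le_sq ?_ hε.le
    linarith
  rwa [map_smul, norm_smul, norm_inv, norm_norm, inv_mul_le_iff₀ hxn, mul_comm] at h2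

/-- With `P` the projection onto the span of the vectors from `exists_small`, `T P` has finite rank
and `T - T P` has small norm. Compact operators are closed in operator norm. -/
theorem HilbertSchmidtBound.isCompactOperator [CompleteSpace E] {T : E →L[ℝ] E} {C : ℝ}
    (h : HilbertSchmidtBound T C) : IsCompactOperator T := by
  have hcl := isClosed_setOfPred_isCompactOperator (𝕜₁ := ℝ) (𝕜₂ := ℝ) (σ₁₂ := RingHom.id ℝ)
    (M₁ := E) (M₂ := E)
  have key : T ∈ closure {f : E →L[ℝ] E | IsCompactOperator f} := by
    refine Metric.mem_closure_iff.2 fun ε hε => ?_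
    obtain ⟨n, e, he⟩ := h.exists_small (half_pos hε)
    let K := Submodule.span ℝ (Set.range e)
    have : FiniteDimensional ℝ K := FiniteDimensional.span_of_finite ℝ (Set.finite_range e)
    have : ProperSpace K := FiniteDimensional.proper_real K
    refine ⟨(T.comp K.subtypeL).comp K.orthogonalProjectionOnto, ?_, ?_⟩
    · exact (isCompactOperator_of_locallyCompactSpace_rng (T.comp K.subtypeL)).comp_clm _
    · rw [dist_eq_norm]
      refine lt_of_le_of_lt (ContinuousLinearMap.opNorm_le_bound _ (half_pos hε).le fun x => ?_)
        (half_lt_self hε)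
      have hx : x - K.starProjection x ∈ Kᗮ := K.sub_starProjection_mem_orthogonal x
      have h1 : ‖T (x - K.starProjection x)‖ ≤ ε / 2 * ‖x - K.starProjection x‖ :=
        he _ fun i => by
          rw [real_inner_comm]
          exact hx _ (Submodule.subset_span ⟨i, rfl⟩)
      have h2 : ‖x - K.starProjection x‖ ≤ ‖x‖ := by
        rw [← K.starProjection_orthogonal_val x]
        exact Kᗮ.norm_starProjection_apply_le x
      calc _ = ‖T (x - K.starProjection x)‖ := by simp
        _ ≤ _ := h1
        _ ≤ _ := by gcongr
  rw [hcl.closure_eq] at key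
  exact key

/-- The squared eigenvalues of a symmetric Hilbert–Schmidt operator, counted with multiplicity,
are summable. -/
theorem HilbertSchmidtBound.summable_finrank_mul_sq {T : E →L[ℝ] E} {C : ℝ}
    (h : HilbertSchmidtBound T C) (hT : T.toLinearMap.IsSymmetric) :
    Summable fun l : ℝ =>
      (Module.finrank ℝ (Module.End.eigenspace T.toLinearMap l) : ℝ) * l ^ 2 := by
  classical
  refine summable_of_sum_le (c := C) (fun l => by positivity) fun s => ?_
  -- No finite dimensionality is needed: an infinite-dimensional eigenspace has `finrank` zero and
  -- contributes the empty family.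
  have hb : ∀ l : ℝ, ∃ b : Fin (Module.finrank ℝ (Module.End.eigenspace T.toLinearMap l)) →
      Module.End.eigenspace T.toLinearMap l, Orthonormal ℝ b := fun l => by
    by_cases hf : FiniteDimensional ℝ (Module.End.eigenspace T.toLinearMap l)
    · exact ⟨stdOrthonormalBasis ℝ _, (stdOrthonormalBasis ℝ _).orthonormal⟩
    · rw [Module.finrank_of_not_finite hf]
      exact ⟨Fin.elim0, fun i => i.elim0, fun i => i.elim0⟩
  choose b hb using hb
  have ho := (hT.orthogonalFamily_eigenspaces.comp
    (Subtype.val_injective (p := (· ∈ s)))).orthonormal_sigma_orthonormal (fun l => hb l)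
  have h1 := h.sum_le ho
  rw [Fintype.sum_sigma] at h1
  refine le_trans (le_of_eq ?_) h1
  rw [← Finset.sum_coe_sort]
  refine Finset.sum_congr rfl fun l _ => ?_
  have h2 : ∀ i, ‖T (b l i : E)‖ ^ 2 = (l : ℝ) ^ 2 := fun i => by
    have h3 : T (b l i : E) = (l : ℝ) • (b l i : E) :=
      Module.End.mem_eigenspace_iff.1 (b l i).2
    have h4 : ‖(b l i : E)‖ = 1 := (hb l).1 i
    rw [h3, norm_smul, h4, mul_one, Real.norm_eq_abs, sq_abs]
  simp [h2]

/-- A compact symmetric operator whose only nonzero eigenvalue is the simple eigenvalue `p`, with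
unit eigenvector `e`, is `p` times the projection onto `e`. -/
theorem eq_smul_inner_of_simple_eigenvalue [CompleteSpace E] {T : E →L[ℝ] E}
    (hc : IsCompactOperator T) (hT : T.toLinearMap.IsSymmetric) {p : ℝ}
    {e : E} (he : ‖e‖ = 1) (hTe : T e = p • e)
    (hl : ∀ l : ℝ, l ≠ 0 → ∀ v, T v = l • v → ∃ c : ℝ, v = c • e) (x : E) :
    T x = (p * inner ℝ e x) • e := by
  have hsym : ∀ x y, inner ℝ (T x) y = inner ℝ x (T y) := hT
  let R : E →L[ℝ] E := (innerSL ℝ e).smulRight (p • e)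
  have hR : ∀ x, R x = (p * inner ℝ e x) • e := fun x => by
    simp [R, smul_smul, mul_comm]
  have hRc : IsCompactOperator R :=
    (isCompactOperator_of_locallyCompactSpace_dom (innerSL ℝ e)).clm_comp (ContinuousLinearMap.toSpanSingleton ℝ (p • e))
  -- `T - R` is compact and symmetric, so it vanishes once it has no nonzero eigenvalue. Since it
  -- kills `e`, an eigenvector for `l ≠ 0` is orthogonal to `e`; it is then an eigenvector of `T`,
  -- hence a multiple of `e`, hence zero.
  have hB : T - R = 0 := by
    refine (ContinuousLinearMap.eq_zero_of_forall_hasEigenvalue_eq_zero (𝕜 := ℝ)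
      (hc.sub hRc) ?_).1 fun l hl' => ?_
    · intro x y
      simp [hR, inner_sub_left, inner_sub_right, hsym, inner_smul_left, inner_smul_right,
        real_inner_comm]
      ring
    · by_contra hl0
      obtain ⟨v, hv⟩ := hl'.exists_hasEigenvector
      have hv1 : T v - (p * inner ℝ e v) • e = l • v := by
        have := hv.apply_eq_smul
        simpa [hR] using this
      have h0 : l * inner ℝ e v = 0 := by
        have := congrArg (inner ℝ e) hv1
        rw [inner_sub_right, ← hsym, hTe, inner_smul_left, inner_smul_right, inner_smul_right,
          real_inner_self_eq_norm_sq, he] at this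
        simp at this
        exact mul_eq_zero.2 this
      have h1 : inner ℝ e v = 0 := (mul_eq_zero.1 h0).resolve_left hl0
      rw [h1, mul_zero, zero_smul, sub_zero] at hv1
      obtain ⟨c, rfl⟩ := hl l hl0 v hv1
      rw [inner_smul_right, real_inner_self_eq_norm_sq, he] at h1
      simp at h1
      exact hv.2 (by simp [h1])
  have := congrArg (fun S : E →L[ℝ] E => S x) hB
  simpa [hR, sub_eq_zero] using this

end HilbertSchmidt

/-! ### Vanishing cut norm. -/

/-- An integrable function on the square with vanishing cut norm vanishes almost everywhere. -/
theorem ae_eq_zero_of_cutNorm_eq_zero {w : unitInterval × unitInterval → ℝ} (hw : Integrable w)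
    (h : cutNorm w = 0) : w =ᵐ[volume] 0 := by
  have hrect : ∀ S T : Set unitInterval, MeasurableSet S → MeasurableSet T →
      ∫ z in S ×ˢ T, w z = 0 := fun S T hS hT =>
    abs_nonpos_iff.1 ((le_cutNorm hw hS hT).trans h.le)
  have htot : ∫ z, w z = 0 := by
    simpa using hrect _ _ MeasurableSet.univ MeasurableSet.univ
  refine Integrable.ae_eq_zero_of_forall_setIntegral_eq_zero hw fun s hs _ => ?_
  -- Rectangles are a π-system generating the σ-algebra.
  induction s, hs using MeasurableSpace.induction_on_inter generateFrom_prod.symm isPiSystem_prod with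
  | empty => simp
  | basic t ht =>
    obtain ⟨S, hS, T, hT, rfl⟩ := ht
    exact hrect S T hS hT
  | compl t ht ih =>
    have := integral_add_compl ht hw
    rw [ih (measure_lt_top _ _), htot, zero_add] at this
    exact this
  | iUnion f hd hf ih =>
    rw [integral_iUnion hf hd hw.integrableOn]
    simp [ih _ (measure_lt_top _ _)]

/-! ### The operator `T_g`: symmetry, Hilbert–Schmidt bound, matrix coefficients. -/

namespace GraphFunction

theorem integralOperator_coeFn (g : GraphFunction) (f : Lp ℝ 2 (volume : Measure unitInterval)) :
    integralOperator g f =ᵐ[volume] kernelIntegral g f :=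
  (memLp_kernelIntegral g f).coeFn_toLp

theorem integrable_kernel_mul (g : GraphFunction) (f h : Lp ℝ 2 (volume : Measure unitInterval)) :
    Integrable fun z : unitInterval × unitInterval => g.toFun z * (h z.1 * f z.2) :=
  ((integrable_of_Lp h).mul_prod (integrable_of_Lp f)).bdd_mul (c := 1)
    g.measurable'.aestronglyMeasurable (Filter.Eventually.of_forall fun z => by
      rw [Real.norm_eq_abs, abs_of_nonneg (g.mem_Icc' _).1]
      exact (g.mem_Icc' _).2)

theorem inner_integralOperator (g : GraphFunction) (f h : Lp ℝ 2 (volume : Measure unitInterval)) :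
    inner ℝ h (integralOperator g f) =
      ∫ z : unitInterval × unitInterval, g.toFun z * (h z.1 * f z.2) := by
  rw [L2.inner_def, Measure.volume_eq_prod, integral_prod _ (g.integrable_kernel_mul f h)]
  refine integral_congr_ae ?_
  filter_upwards [g.integralOperator_coeFn f] with x hx
  rw [hx, kernelIntegral]
  simp only [RCLike.inner_apply, conj_trivial]
  rw [← integral_mul_const]
  exact integral_congr_ae (Filter.Eventually.of_forall fun y => by ring)

theorem isSymmetric_integralOperator (g : GraphFunction) :
    (integralOperator g).toLinearMap.IsSymmetric := by
  intro f h
  change inner ℝ (integralOperator g f) h = inner ℝ f (integralOperator g h)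
  rw [real_inner_comm, inner_integralOperator, inner_integralOperator]
  rw [Measure.volume_eq_prod, ← integral_prod_swap]
  refine integral_congr_ae ?_
  filter_upwards [g.symm'] with z hz
  rw [Prod.swap, ← hz]
  simp only [Prod.mk.eta]
  ring

theorem memLp_slice (g : GraphFunction) (x : unitInterval) :
    MemLp (fun y => g.toFun (x, y)) 2 (volume : Measure unitInterval) :=
  MemLp.of_bound (g.measurable'.comp measurable_prodMk_left).aestronglyMeasurable 1
    (Filter.Eventually.of_forall fun y => by
      rw [Real.norm_eq_abs, abs_of_nonneg (g.mem_Icc' _).1]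
      exact (g.mem_Icc' _).2)

theorem kernelIntegral_eq_inner (g : GraphFunction) (f : Lp ℝ 2 (volume : Measure unitInterval)) (x : unitInterval) :
    kernelIntegral g f x = inner ℝ f ((g.memLp_slice x).toLp) := by
  rw [L2.inner_def, kernelIntegral]
  refine integral_congr_ae ?_
  filter_upwards [(g.memLp_slice x).coeFn_toLp] with y hy
  rw [hy]
  simp

theorem norm_slice_le (g : GraphFunction) (x : unitInterval) : ‖(g.memLp_slice x).toLp‖ ≤ 1 := by
  refine (Lp.norm_le_of_ae_bound zero_le_one (C := 1) ?_).trans ?_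
  · filter_upwards [(g.memLp_slice x).coeFn_toLp] with y hy
    rw [hy, Real.norm_eq_abs, abs_of_nonneg (g.mem_Icc' _).1]
    exact (g.mem_Icc' _).2
  · simp [measureUnivNNReal]

theorem norm_sq_integralOperator (g : GraphFunction) (f : Lp ℝ 2 (volume : Measure unitInterval)) :
    ‖integralOperator g f‖ ^ 2 = ∫ x, kernelIntegral g f x ^ 2 := by
  rw [← real_inner_self_eq_norm_sq, L2.inner_def]
  refine integral_congr_ae ?_
  filter_upwards [g.integralOperator_coeFn f] with x hx
  rw [hx]
  simp [sq]

/-- Since `(T_g e_i)(x) = ⟨e_i, g (x, ·)⟩`, Bessel's inequality bounds the sum of squares at each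
`x` by `‖g (x, ·)‖² ≤ 1`; then integrate over `x`. -/
theorem hilbertSchmidtBound_integralOperator (g : GraphFunction) :
    HilbertSchmidtBound (integralOperator g) 1 := by
  intro n e he
  simp_rw [norm_sq_integralOperator]
  rw [← integral_finsetSum _ fun i _ => (memLp_kernelIntegral g (e i)).integrable_sq]
  calc _ ≤ ∫ _ : unitInterval, (1 : ℝ) := ?_
    _ = 1 := by simp
  refine integral_mono (integrable_finsetSum _ fun i _ =>
    (memLp_kernelIntegral g (e i)).integrable_sq) (integrable_const _) fun x => ?_
  have h := he.sum_inner_products_le ((g.memLp_slice x).toLp) (s := Finset.univ)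
  simp only [kernelIntegral_eq_inner]
  simp only [Real.norm_eq_abs, sq_abs] at h
  exact h.trans (pow_le_one₀ (norm_nonneg _) (g.norm_slice_le x))

theorem isCompactOperator_integralOperator (g : GraphFunction) :
    IsCompactOperator (integralOperator g) :=
  g.hilbertSchmidtBound_integralOperator.isCompactOperator

/-- The indicator function of a measurable set, as an element of `L²([0,1])`. -/
noncomputable def indicatorL2 {S : Set unitInterval} (hS : MeasurableSet S) : Lp ℝ 2 (volume : Measure unitInterval) :=
  indicatorConstLp 2 hS (measure_ne_top _ _) 1

theorem inner_indicatorL2_indicatorL2 {S T : Set unitInterval} (hS : MeasurableSet S)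
    (hT : MeasurableSet T) :
    inner ℝ (indicatorL2 hS) (indicatorL2 hT) = volume.real (S ∩ T) := by
  rw [indicatorL2, indicatorL2, L2.inner_indicatorConstLp_indicatorConstLp]
  simp

/-- Links the operator to the cut norm, which sees only rectangle integrals. -/
theorem inner_indicatorL2_integralOperator (g : GraphFunction) {S T : Set unitInterval}
    (hS : MeasurableSet S) (hT : MeasurableSet T) :
    inner ℝ (indicatorL2 hS) (integralOperator g (indicatorL2 hT)) =
      ∫ z in S ×ˢ T, g.toFun z := by
  rw [inner_integralOperator, ← integral_indicator (hS.prod hT)]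
  have h1 : (indicatorL2 hS : unitInterval → ℝ) =ᵐ[volume] S.indicator fun _ => 1 :=
    indicatorConstLp_coeFn
  have h2 : (indicatorL2 hT : unitInterval → ℝ) =ᵐ[volume] T.indicator fun _ => 1 :=
    indicatorConstLp_coeFn
  refine integral_congr_ae ?_
  filter_upwards [Measure.quasiMeasurePreserving_fst.ae_eq_comp h1,
    Measure.quasiMeasurePreserving_snd.ae_eq_comp h2] with z hz1 hz2
  simp only [Function.comp_apply] at hz1 hz2
  rw [hz1, hz2]
  by_cases ha : z.1 ∈ S <;> by_cases hb : z.2 ∈ T <;> simp [Set.indicator, Set.mem_prod, ha, hb]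

/-- The constant function `1` in `L²([0,1])`. -/
noncomputable def oneL2 : Lp ℝ 2 (volume : Measure unitInterval) := indicatorL2 MeasurableSet.univ

theorem norm_oneL2 : ‖oneL2‖ = 1 := by
  rw [← sq_eq_sq₀ (norm_nonneg _) zero_le_one, ← real_inner_self_eq_norm_sq, oneL2,
    inner_indicatorL2_indicatorL2]
  simp

theorem oneL2_ne_zero : oneL2 ≠ 0 := by
  rw [← norm_ne_zero_iff, norm_oneL2]
  exact one_ne_zero

theorem inner_indicatorL2_oneL2 {S : Set unitInterval} (hS : MeasurableSet S) :
    inner ℝ (indicatorL2 hS) oneL2 = volume.real S := by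
  rw [oneL2, inner_indicatorL2_indicatorL2, Set.inter_univ]

theorem inner_oneL2_integralOperator_oneL2 (g : GraphFunction) :
    inner ℝ oneL2 (integralOperator g oneL2) = edgeDensity g := by
  rw [oneL2, inner_indicatorL2_integralOperator, edgeDensity]
  simp

theorem integralOperator_apply_of_ae_eq_const {g : GraphFunction} {p : ℝ}
    (h : g.toFun =ᵐ[volume] fun _ => p) (f : Lp ℝ 2 (volume : Measure unitInterval)) :
    integralOperator g f = (p * inner ℝ oneL2 f) • oneL2 := by
  have h' : ∀ᵐ x : unitInterval, ∀ᵐ y : unitInterval, g.toFun (x, y) = p :=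
    Measure.ae_ae_of_ae_prod h
  refine Lp.ext ?_
  have h1 : (oneL2 : unitInterval → ℝ) =ᵐ[volume] Set.univ.indicator fun _ => 1 :=
    indicatorConstLp_coeFn (hs := MeasurableSet.univ) (hμs := measure_ne_top _ _)
  filter_upwards [h', h1, g.integralOperator_coeFn f,
    Lp.coeFn_smul (p * inner ℝ oneL2 f) oneL2] with x hx hx1 hx2 hx3
  rw [hx2, hx3, Pi.smul_apply, hx1, kernelIntegral, oneL2, indicatorL2,
    L2.inner_indicatorConstLp_one]
  simp only [Set.indicator_univ, smul_eq_mul, mul_one, Measure.restrict_univ]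
  rw [← integral_const_mul]
  refine integral_congr_ae ?_
  filter_upwards [hx] with y hy
  rw [hy]

end GraphFunction

/-! ### Convergence of the determinant. -/

/-- The factor `(1 + w) exp (-w + w² / 2)` of the `3`-modified determinant is within `O(|w|²)` of
`1` on bounded sets. -/
theorem norm_one_add_mul_exp_sub_one_le {w : ℂ} {R : ℝ} (hw : ‖w‖ ≤ R) :
    ‖(1 + w) * Complex.exp (-w + w ^ 2 / 2) - 1‖ ≤
      ((1 + R) * ((1 / 2) + (1 + R) ^ 2 * Real.exp (R + R ^ 2)) + (1 + R)) * ‖w‖ ^ 2 := by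
  have hR : 0 ≤ R := (norm_nonneg w).trans hw
  set u : ℂ := -w + w ^ 2 / 2 with hu
  have hsq : ‖w‖ ^ 2 ≤ R ^ 2 := by gcongr
  have hu1 : ‖u‖ ≤ ‖w‖ + ‖w‖ ^ 2 / 2 := by
    refine (norm_add_le _ _).trans (le_of_eq ?_)
    simp
  have hu2 : ‖u‖ ≤ (1 + R) * ‖w‖ := by nlinarith [norm_nonneg w]
  have hu3 : ‖u‖ ≤ R + R ^ 2 := by nlinarith [norm_nonneg w]
  have he := Complex.norm_exp_sub_sum_le_norm_mul_exp u 2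
  simp only [Finset.sum_range_succ, Finset.sum_range_zero, pow_zero, pow_one, Nat.factorial,
    zero_add] at he
  have he' : ‖Complex.exp u - (1 + u)‖ ≤ (1 + R) ^ 2 * Real.exp (R + R ^ 2) * ‖w‖ ^ 2 := by
    calc _ ≤ ‖u‖ ^ 2 * Real.exp ‖u‖ := by simpa using he
      _ ≤ ((1 + R) * ‖w‖) ^ 2 * Real.exp (R + R ^ 2) := by gcongr
      _ = _ := by ring
  -- As `1 + u = 1 - w + w² / 2`, the linear terms of `(1 + w) (1 + u)` cancel, leaving only
  -- quadratic terms and the Taylor remainder.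
  have hdec : (1 + w) * Complex.exp u - 1 =
      (1 + w) * (w ^ 2 / 2 + (Complex.exp u - (1 + u))) - w ^ 2 := by
    rw [hu]; ring
  have h1w : ‖1 + w‖ ≤ 1 + R := (norm_add_le _ _).trans (by simpa using hw)
  rw [hdec]
  calc _ ≤ ‖1 + w‖ * (‖w ^ 2 / 2‖ + ‖Complex.exp u - (1 + u)‖) + ‖w ^ 2‖ := by
        refine (norm_sub_le _ _).trans ?_
        rw [norm_mul]
        gcongr
        exact norm_add_le _ _
    _ ≤ (1 + R) * (‖w‖ ^ 2 / 2 + (1 + R) ^ 2 * Real.exp (R + R ^ 2) * ‖w‖ ^ 2)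
        + (1 + R) * ‖w‖ ^ 2 := by
        gcongr
        · simp
        · rw [norm_pow]
          exact le_mul_of_one_le_left (by positivity) (by linarith)
    _ = _ := by ring

/-- With `t = n ‖a - 1‖`, expanding the product of `n` factors `1 + (a - 1)` gives the bound `exp t
- 1`, which is at most `t exp t`. -/
theorem norm_pow_sub_one_le (a : ℂ) (n : ℕ) :
    ‖a ^ n - 1‖ ≤ (n * ‖a - 1‖) * Real.exp (n * ‖a - 1‖) := by
  have h := Finset.norm_prod_one_add_sub_one_le (Finset.range n) (fun _ => a - 1)
  simp only [add_sub_cancel, Finset.prod_const, Finset.card_range, Finset.sum_const,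
    nsmul_eq_mul] at h
  refine h.trans ?_
  set t := (n : ℝ) * ‖a - 1‖
  have h1 := Real.add_one_le_exp (-t)
  have h2 : Real.exp (-t) * Real.exp t = 1 := by rw [← Real.exp_add]; simp
  nlinarith [Real.exp_pos t]

theorem multipliable_pow_of_summable {ι : Type*} {a : ι → ℂ} {n : ι → ℕ}
    (h : Summable fun i => (n i : ℝ) * ‖a i - 1‖) : Multipliable fun i => a i ^ n i := by
  have h1 : Summable fun i => ‖a i ^ n i - 1‖ := by
    refine Summable.of_nonneg_of_le (fun _ => norm_nonneg _) (fun i => ?_)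
      (h.mul_right (Real.exp (∑' i, (n i : ℝ) * ‖a i - 1‖)))
    refine (norm_pow_sub_one_le _ _).trans ?_
    gcongr
    exact h.le_tsum i fun j _ => by positivity
  simpa using multipliable_one_add_of_summable h1

namespace GraphFunction

theorem detFactor_eq (g : GraphFunction) (z : ℂ) (l : ℝ) : detFactor g z l =
    ((1 + z * l) * Complex.exp (-(z * l) + (z * l) ^ 2 / 2)) ^ multiplicity g l := by
  rw [detFactor, mul_pow z]

theorem multipliable_detFactor (g : GraphFunction) (z : ℂ) :
    Multipliable fun l : ℝ => detFactor g z l := by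
  have hs : Summable fun l : ℝ => (multiplicity g l : ℝ) * l ^ 2 :=
    g.hilbertSchmidtBound_integralOperator.summable_finrank_mul_sq g.isSymmetric_integralOperator
  simp_rw [detFactor_eq]
  refine multipliable_pow_of_summable ?_
  set S := ∑' l : ℝ, (multiplicity g l : ℝ) * l ^ 2
  -- For an eigenvalue of positive multiplicity `l² ≤ S`, so `|l| ≤ 1 + l² ≤ 1 + S`; this bounds `‖z
  -- l‖` uniformly.
  set R := ‖z‖ * (1 + S)
  refine Summable.of_nonneg_of_le (fun _ => by positivity) (fun l => ?_)
    (hs.mul_left (((1 + R) * ((1 / 2) + (1 + R) ^ 2 * Real.exp (R + R ^ 2)) + (1 + R)) * ‖z‖ ^ 2))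
  rcases Nat.eq_zero_or_pos (multiplicity g l) with h0 | h0
  · simp [h0]
  have h1 : (1 : ℝ) ≤ multiplicity g l := by exact_mod_cast h0
  have h2 : (multiplicity g l : ℝ) * l ^ 2 ≤ S := hs.le_tsum l fun j _ => by positivity
  have h3 : |l| ≤ 1 + S := by
    rw [abs_le]
    constructor <;> nlinarith [sq_nonneg l, sq_nonneg (l - 1), sq_nonneg (l + 1)]
  have hw : ‖z * (l : ℂ)‖ ≤ R := by
    rw [norm_mul, Complex.norm_real, Real.norm_eq_abs]
    exact mul_le_mul_of_nonneg_left h3 (norm_nonneg z)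
  calc _ ≤ _ := mul_le_mul_of_nonneg_left (norm_one_add_mul_exp_sub_one_le hw)
        (Nat.cast_nonneg (multiplicity g l))
    _ = _ := by
      rw [norm_mul, Complex.norm_real, Real.norm_eq_abs, mul_pow ‖z‖ |l|, sq_abs]
      ring

/-! ### Multiplicities and the determinant of a constant kernel. -/

theorem detFactor_zero_right (g : GraphFunction) (z : ℂ) : detFactor g z 0 = 1 := by
  simp [detFactor]

theorem multiplicity_pos_of_eigenvector {g : GraphFunction} {l : ℝ} (hl : l ≠ 0)
    {v : Lp ℝ 2 (volume : Measure unitInterval)} (hv : v ≠ 0)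
    (h : integralOperator g v = l • v) : 0 < multiplicity g l := by
  have := ContinuousLinearMap.finite_dimensional_eigenspace
    g.isCompactOperator_integralOperator l hl
  have hnt : Nontrivial (Module.End.eigenspace (integralOperator g).toLinearMap l) :=
    ⟨⟨⟨v, Module.End.mem_eigenspace_iff.2 h⟩, 0, fun h' => hv (congrArg Subtype.val h')⟩⟩
  exact Module.finrank_pos

theorem multiplicity_eq_zero_of_forall {g : GraphFunction} {l : ℝ}
    (h : ∀ v, integralOperator g v = l • v → v = 0) : multiplicity g l = 0 := by
  have hb : Module.End.eigenspace (integralOperator g).toLinearMap l = ⊥ :=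
    (Submodule.eq_bot_iff _).2 fun v hv => h v (Module.End.mem_eigenspace_iff.1 hv)
  rw [multiplicity, hb, finrank_bot]

theorem det₃_of_ae_eq_const {g : GraphFunction} {p : ℝ} (h : g.toFun =ᵐ[volume] fun _ => p)
    (z : ℂ) : det₃ g z =
      (1 + (p : ℂ) * z) * Complex.exp (-((p : ℂ) * z) + (p : ℂ) ^ 2 * z ^ 2 / 2) := by
  have hT := integralOperator_apply_of_ae_eq_const h
  have hone : inner ℝ oneL2 oneL2 = (1 : ℝ) := by
    rw [real_inner_self_eq_norm_sq, norm_oneL2, one_pow]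
  have hv : ∀ l : ℝ, l ≠ 0 → ∀ v, integralOperator g v = l • v →
      v = (l⁻¹ * (p * inner ℝ oneL2 v)) • oneL2 := fun l hl v hv => by
    rw [hT] at hv
    rw [mul_smul, hv, smul_smul, inv_mul_cancel₀ hl, one_smul]
  have hother : ∀ l : ℝ, l ≠ p → detFactor g z l = 1 := fun l hlp => by
    rcases eq_or_ne l 0 with rfl | hl
    · exact detFactor_zero_right g z
    rw [detFactor, multiplicity_eq_zero_of_forall, pow_zero]
    intro v hev
    have h1 := hv l hl v hev
    rw [hT] at hev
    have h2 := congrArg (inner ℝ oneL2) hev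
    rw [inner_smul_right, inner_smul_right, hone, mul_one] at h2
    have h3 : inner ℝ oneL2 v = (0 : ℝ) := by
      by_contra h3
      exact hlp (mul_right_cancel₀ h3 h2).symm
    rw [h1, h3, mul_zero, mul_zero, zero_smul]
  rw [det₃, tprod_eq_mulSingle p hother]
  -- For `p = 0` the surviving factor sits at `l = 0` and equals `1` whatever its exponent.
  rcases eq_or_ne p 0 with rfl | hp
  · simp [detFactor_zero_right]
  have hm : multiplicity g p = 1 := by
    have hspan : Module.End.eigenspace (integralOperator g).toLinearMap p =
        Submodule.span ℝ {oneL2} := by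
      ext v
      rw [Module.End.mem_eigenspace_iff, Submodule.mem_span_singleton]
      refine ⟨fun h => ⟨_, (hv p hp v h).symm⟩, ?_⟩
      rintro ⟨c, rfl⟩
      change integralOperator g _ = _
      rw [hT, inner_smul_right, hone, mul_one, smul_smul]
    rw [multiplicity, hspan, finrank_span_singleton oneL2_ne_zero]
  rw [detFactor, hm, pow_one, mul_comm z]
  ring_nf

/-- Undoing `σ` fixes the constant, so no relabelling brings `g` closer to `p` than `g` itself. -/
theorem ae_eq_const_of_cutDist_eq_zero {g : GraphFunction} {p : ℝ} {hp : p ∈ Set.Icc (0 : ℝ) 1}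
    (h : cutDist g (const p hp) = 0) : g.toFun =ᵐ[volume] fun _ => p := by
  have hw : Integrable fun z => g.toFun z - p := g.integrable.sub (integrable_const p)
  have hle : cutNorm (fun z => g.toFun z - p) ≤ cutDist g (const p hp) := by
    refine le_ciInf fun σ => ?_
    have h1 := cutNorm_relabel_le σ.inv
      ((integrable_relabel σ g.integrable).sub (const p hp).integrable)
    refine le_trans (le_of_eq ?_) h1
    congr 1
    funext z
    simp [relabel, LebesgueIso.inv, const]
  filter_upwards [ae_eq_zero_of_cutNorm_eq_zero hw
    (le_antisymm (hle.trans h.le) (cutNorm_nonneg _))] with z hz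
  exact sub_eq_zero.1 hz

theorem cutDist_const_eq_zero {g : GraphFunction} {p : ℝ} (hp : p ∈ Set.Icc (0 : ℝ) 1)
    (h : ∀ S T : Set unitInterval, MeasurableSet S → MeasurableSet T →
      ∫ z in S ×ˢ T, g.toFun z = p * (volume.real S * volume.real T)) :
    cutDist g (const p hp) = 0 := by
  refine le_antisymm ((cutDist_le g _ LebesgueIso.id).trans (le_of_eq ?_)) (cutDist_nonneg _ _)
  have h0 : ∀ P : {S : Set unitInterval // MeasurableSet S} ×
      {T : Set unitInterval // MeasurableSet T},
      |∫ z in (P.1 : Set unitInterval) ×ˢ (P.2 : Set unitInterval),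
        (relabel LebesgueIso.id g.toFun z - (const p hp).toFun z)| = 0 := fun P => by
    change |∫ z in (P.1 : Set unitInterval) ×ˢ (P.2 : Set unitInterval), (g.toFun z - p)| = 0
    rw [integral_sub g.integrable.integrableOn (integrable_const p), h _ _ P.1.2 P.2.2,
      setIntegral_const, Measure.volume_eq_prod, measureReal_prod_prod, smul_eq_mul, mul_comm p,
      sub_self, abs_zero]
  simp [cutNorm, h0]

/-! ### From density and determinant back to the constant graphon. -/

theorem cutDist_zero_of_edgeDensity_eq_zero {g : GraphFunction} (hd : edgeDensity g = 0)
    (h0 : (0 : ℝ) ∈ Set.Icc (0 : ℝ) 1) : cutDist g (const 0 h0) = 0 := by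
  have hg : g.toFun =ᵐ[volume] 0 :=
    (integral_eq_zero_iff_of_nonneg (fun z => (g.mem_Icc' z).1) g.integrable).1 hd
  refine cutDist_const_eq_zero h0 fun S T _ _ => ?_
  rw [integral_congr_ae (ae_restrict_of_ae hg)]
  simp

/-- An eigenvalue `l` puts a zero factor into the product at `z = -1/l`, where the right-hand side
vanishes only if `l = p`. -/
theorem multiplicity_eq_zero_of_det₃ {g : GraphFunction} {p : ℝ}
    (h : ∀ z : ℂ, det₃ g z =
      (1 + (p : ℂ) * z) * Complex.exp (-((p : ℂ) * z) + (p : ℂ) ^ 2 * z ^ 2 / 2))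
    {l : ℝ} (hl : l ≠ 0) (hlp : l ≠ p) : multiplicity g l = 0 := by
  by_contra hm
  have hlC : (l : ℂ) ≠ 0 := Complex.ofReal_ne_zero.2 hl
  have h1 : det₃ g (-(l : ℂ)⁻¹) = 0 :=
    tprod_of_exists_eq_zero ⟨l, by simp [detFactor, hlC, hm]⟩
  rw [h] at h1
  have h2 := (mul_eq_zero.1 h1).resolve_right (Complex.exp_ne_zero _)
  have h3 : (l : ℂ) = p := by
    field_simp at h2
    linear_combination h2
  exact hlp (Complex.ofReal_injective h3)

theorem multiplicity_eq_one_of_det₃ {g : GraphFunction} {p : ℝ} (hp : p ≠ 0)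
    (h : ∀ z : ℂ, det₃ g z =
      (1 + (p : ℂ) * z) * Complex.exp (-((p : ℂ) * z) + (p : ℂ) ^ 2 * z ^ 2 / 2)) :
    multiplicity g p = 1 := by
  have hpC : (p : ℂ) ≠ 0 := Complex.ofReal_ne_zero.2 hp
  have hone : ∀ l : ℝ, l ≠ p → detFactor g (p : ℂ)⁻¹ l = 1 := fun l hlp => by
    rcases eq_or_ne l 0 with rfl | hl
    · exact detFactor_zero_right g _
    · rw [detFactor, multiplicity_eq_zero_of_det₃ h hl hlp, pow_zero]
  -- At `-1/p` both sides could vanish whatever the multiplicity; at `1/p` the identity reads `a ^ m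
  -- = a` with `a = 2 exp (-1/2) > 1`, so `m = 1`. This avoids orders of zeros.
  have h1 := h (p : ℂ)⁻¹
  rw [det₃, tprod_eq_mulSingle p hone, detFactor, ← mul_pow, ← mul_pow, inv_mul_cancel₀ hpC,
    mul_inv_cancel₀ hpC] at h1
  set a : ℝ := (1 + 1) * Real.exp (-1 + 1 ^ 2 / 2) with ha
  have h2 : a ^ multiplicity g p = a ^ 1 := by
    rw [pow_one]
    apply Complex.ofReal_injective
    rw [ha]
    push_cast
    exact h1
  have ha1 : 1 < a := by
    have h3 := Real.add_one_lt_exp (show (-1 + 1 ^ 2 / 2 : ℝ) ≠ 0 by norm_num)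
    rw [ha]
    linarith
  exact pow_right_injective₀ (by linarith) ha1.ne' h2

theorem cutDist_const_eq_zero_of_det₃ {g : GraphFunction} {p : ℝ} (hp : p ∈ Set.Icc (0 : ℝ) 1)
    (hd : edgeDensity g = p)
    (h : ∀ z : ℂ, det₃ g z =
      (1 + (p : ℂ) * z) * Complex.exp (-((p : ℂ) * z) + (p : ℂ) ^ 2 * z ^ 2 / 2)) :
    cutDist g (const p hp) = 0 := by
  rcases eq_or_ne p 0 with rfl | hp0
  · exact cutDist_zero_of_edgeDensity_eq_zero hd hp
  obtain ⟨⟨v, hv⟩, hv0, hvs⟩ := finrank_eq_one_iff'.1 (multiplicity_eq_one_of_det₃ hp0 h)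
  have hv0' : v ≠ 0 := fun h' => hv0 (Subtype.ext h')
  have hvn : ‖v‖ ≠ 0 := norm_ne_zero_iff.2 hv0'
  set e := ‖v‖⁻¹ • v with he
  have hen : ‖e‖ = 1 := by rw [he, norm_smul, norm_inv, norm_norm, inv_mul_cancel₀ hvn]
  have hTv : integralOperator g v = p • v := Module.End.mem_eigenspace_iff.1 hv
  have hT := eq_smul_inner_of_simple_eigenvalue g.isCompactOperator_integralOperator
    g.isSymmetric_integralOperator hen (p := p) (by rw [he, map_smul, hTv, smul_comm])
    (fun l hl w hw => by
      rcases eq_or_ne l p with rfl | hlp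
      · obtain ⟨c, hc⟩ := hvs ⟨w, Module.End.mem_eigenspace_iff.2 hw⟩
        refine ⟨c * ‖v‖, ?_⟩
        rw [he, smul_smul, mul_assoc, mul_inv_cancel₀ hvn, mul_one]
        exact (congrArg Subtype.val hc).symm
      · refine ⟨0, ?_⟩
        rw [zero_smul]
        by_contra hw0
        exact (multiplicity_pos_of_eigenvector hl hw0 hw).ne'
          (multiplicity_eq_zero_of_det₃ h hl hlp))
  -- The density is `⟨1, T_g 1⟩ = p ⟨1, e⟩²`.
  have h1 : inner ℝ oneL2 e ^ 2 = (1 : ℝ) := by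
    have := inner_oneL2_integralOperator_oneL2 g
    rw [hT, inner_smul_right, real_inner_comm oneL2 e, hd] at this
    exact mul_left_cancel₀ hp0 (by linarith)
  -- Equality in Cauchy–Schwarz: `‖1 - ⟨1, e⟩ e‖² = 1 - ⟨1, e⟩² = 0`.
  have he1 : oneL2 = (inner ℝ oneL2 e : ℝ) • e := by
    rw [← sub_eq_zero, ← norm_eq_zero, ← sq_eq_zero_iff, norm_sub_sq_real, inner_smul_right,
      norm_smul, norm_oneL2, hen, Real.norm_eq_abs, mul_one, sq_abs]
    linarith
  have hone : ∀ f, inner ℝ f oneL2 = inner ℝ oneL2 e * inner ℝ f e := fun f => by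
    rw [← inner_smul_right, ← he1]
  refine cutDist_const_eq_zero hp fun S T hS hT' => ?_
  rw [← inner_indicatorL2_integralOperator g hS hT', hT, ← inner_indicatorL2_oneL2 hS,
    ← inner_indicatorL2_oneL2 hT', hone, hone, inner_smul_right, real_inner_comm (indicatorL2 hT') e]
  linear_combination (-p * inner ℝ (indicatorL2 hT') e * inner ℝ (indicatorL2 hS) e) * h1

end GraphFunction

/-- For every representative `g` of the graphon `γ`, the product defining `det₃` converges, and
`γ = γ_p` iff `γ` has edge density `p` and the stated `3`-modified Fredholm determinant, computed
from `g`. -/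
theorem mainTheorem10 (γ : Graphon) (g : GraphFunction) (hg : Graphon.mk g = γ)
    (p : ℝ) (hp : p ∈ Set.Icc (0 : ℝ) 1) :
    (∀ z : ℂ, Multipliable (fun l : ℝ => GraphFunction.detFactor g z l)) ∧
    (γ = Graphon.const p hp ↔
      γ.edgeDensity = p ∧
        ∀ z : ℂ, GraphFunction.det₃ g z =
          (1 + (p : ℂ) * z) * Complex.exp (-((p : ℂ) * z) + (p : ℂ) ^ 2 * z ^ 2 / 2)) := by
  subst hg
  refine ⟨g.multipliable_detFactor, fun h => ?_, fun h => ?_⟩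
  · have hae := GraphFunction.ae_eq_const_of_cutDist_eq_zero (Quotient.exact h)
    refine ⟨?_, GraphFunction.det₃_of_ae_eq_const hae⟩
    change ∫ z, g.toFun z = p
    rw [integral_congr_ae hae]
    simp
  · exact Quotient.sound (GraphFunction.cutDist_const_eq_zero_of_det₃ hp h.1 h.2)
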